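/- Let $\kappa_\alpha,\kappa_q,M,a_n,b_n,c_n,d_n,a_m,b_m,c_m,d_m\in\mathbb R$ and consider, with state $x=(\alpha,q)\in\mathbb R^2$, $$\dot\alpha=\kappa_\alpha M\big((a_n\alpha^2+b_n\alpha+c_n)\alpha+d_n\delta\big)+q,\qquad \dot q=\kappa_q M\big((a_m\alpha^2+b_m\alpha+c_m)\alpha+d_m\delta\big).$$ Put $\varphi(x)=\big(\kappa_\alpha M(a_n\alpha^2+b_n\alpha+c_n),\ \kappa_qM(a_m\alpha^2+b_m\alpha+c_m)\big)$ and, for $\theta\in\mathbb R^2$ and a function $K:\mathbb R^2\to\mathbb R$, $$\tilde A(\theta)=\begin{bmatrix}\theta_1&1\\ \theta_2&0\end{bmatrix}+K(\theta)\begin{bmatrix}\kappa_\alpha Md_n\\ \kappa_qMd_m\end{bmatrix}\begin{bmatrix}1&0\end{bmatrix}.$$ With $\delta=K(\theta)\alpha$ and $\theta=\varphi(x)$ this gives the closed-loop system $\dot x=\tilde A(\varphi(x))\,x$, along which $\dot\theta=\psi(x)$, where $$\psi(x)=\big(\kappa_\alpha M(2a_n\alpha+b_n)\dot\alpha,\ \kappa_qM(2a_m\alpha+b_m)\dot\alpha\big)$$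 and $\dot\alpha=\kappa_\alpha M\big((a_n\alpha^2+b_n\alpha+c_n)\alpha+d_nK(\varphi(x))\alpha\big)+q$. Let $\mathcal D\subset\mathbb R^2$ with $0\in\mathcal D$, and let $\mathcal E=\varphi(\mathcal D)$, $\mathcal F=\psi(\mathcal D)$. Below, $\|\cdot\|$ is the Euclidean norm or the matrix norm induced by it. Assume the following. (Gain.) There are polynomials $\eta(\theta,t)$ and $\varrho_K(\theta,t)$ with real coefficients such that, for every $\theta\in\mathcal E$, $K(\theta)=\varrho_K(\theta,\bar t_\theta)$ for some $\bar t_\theta\in\mathbb R$ with $\eta(\theta,\bar t_\theta)=0$. (Slow variation.) There are constants $L_A>0$, $m\ge1$, $\lambda>0$ such that 1. $\|\tilde A(\theta)-\tilde A(\theta')\|\le L_A\|\theta-\theta'\|$ for all $\theta,\theta'\in\mathcal E$; 2. for each fixed $\bar\theta\in\mathcal E$, every solution of $\dot x=\tilde A(\bar\theta)x$ satisfies $\|x(t)\|\le me^{-\lambda t}\|x(0)\|$ for all $t\ge0$; 3. $\|\omega\|<\dfrac{\lambda^2}{4L_Am\log m}$ for all $\omega\in\mathcal F$ (no condition if $m=1$).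 Then there is a set $\mathcal L\subset\mathcal D$, which is a neighbourhood of $0$ whenever $\mathcal D$ is one, such that for every $x_0\in\mathcal L$ the closed-loop system has a solution on $[0,\infty)$ with $x(0)=x_0$ that stays in $\mathcal D$ for all $t\ge0$, and every solution with $x(0)=x_0$, on any interval $[0,T)$, stays in $\mathcal D$ for all $t\in[0,T)$. -/

import Mathlib

open scoped Topology

noncomputable section

namespace MissileLPV

/-- The plane `ℝ²` with the Euclidean norm: it carries the states `x = (α, q)`, the parameters
`θ = (θ₁, θ₂)` and the parameter rates. -/
abbrev Plane : Type := EuclideanSpace ℝ (Fin 2)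

/-- The Mach number and the aerodynamic coefficients of the missile model
`α' = κα M ((an α² + bn α + cn) α + dn δ) + q`, `q' = κq M ((am α² + bm α + cm) α + dm δ)`. -/
structure Coeffs where
  (κα κq M an bn cn dn am bm cm dm : ℝ)

/-- The operator on the Euclidean plane given by a matrix; its norm is the spectral norm. -/
abbrev op (A : Matrix (Fin 2) (Fin 2) ℝ) : Plane →L[ℝ] Plane :=
  Matrix.toEuclideanCLM (n := Fin 2) (𝕜 := ℝ) A

/-- `x` is a classical solution of `x' = f (x)` on the time interval `I` (with one-sided
derivatives at the end points that belong to `I`). -/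
def IsSolutionOn (f : Plane → Plane) (I : Set ℝ) (x : ℝ → Plane) : Prop :=
  ∀ t ∈ I, HasDerivWithinAt x (f (x t)) I t

/-- The gain obtained from two polynomials `η (θ, t)` and `ϱ (θ, t)` (the variables with indices
`0, 1, 2` are `θ₁, θ₂, t`): for every `θ ∈ E` one has `K θ = ϱ (θ, t_θ)` for a real root `t_θ` of
`η (θ, ·)`. -/
def IsRootGain (η ϱ : MvPolynomial (Fin 3) ℝ) (E : Set Plane) (K : Plane → ℝ) : Prop :=
  ∃ tbar : Plane → ℝ, ∀ θ ∈ E,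
    MvPolynomial.eval ![θ 0, θ 1, tbar θ] η = 0 ∧
      K θ = MvPolynomial.eval ![θ 0, θ 1, tbar θ] ϱ

namespace Coeffs

variable (c : Coeffs)

/-- The matrix `A (θ)`. -/
def A (θ : Plane) : Matrix (Fin 2) (Fin 2) ℝ := !![θ 0, 1; θ 1, 0]

/-- The input matrix `B`. -/
def B : Matrix (Fin 2) (Fin 1) ℝ := !![c.κα * c.M * c.dn; c.κq * c.M * c.dm]

/-- The output matrix `C`. -/
def C : Matrix (Fin 1) (Fin 2) ℝ := !![1, 0]

/-- The closed-loop dynamic matrix `Ã (θ) = A (θ) + B K (θ) C`. -/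
def Atilde (K : Plane → ℝ) (θ : Plane) : Matrix (Fin 2) (Fin 2) ℝ :=
  A θ + K θ • (c.B * C)

/-- The scheduling parameters as functions of the state, `θ = φ (x)`. -/
def φ (x : Plane) : Plane :=
  !₂[c.κα * c.M * (c.an * x 0 ^ 2 + c.bn * x 0 + c.cn),
     c.κq * c.M * (c.am * x 0 ^ 2 + c.bm * x 0 + c.cm)]

/-- The rate `α'` in the missile model with the input `δ = K (θ) α`. -/
def alphaDot (K : Plane → ℝ) (x : Plane) : ℝ :=
  c.κα * c.M * ((c.an * x 0 ^ 2 + c.bn * x 0 + c.cn) * x 0 + c.dn * (K (c.φ x) * x 0)) + x 1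

/-- The parameter rates along the closed loop as functions of the state, `θ' = ψ (x)`. -/
def ψ (K : Plane → ℝ) (x : Plane) : Plane :=
  !₂[c.κα * c.M * (2 * c.an * x 0 + c.bn) * c.alphaDot K x,
     c.κq * c.M * (2 * c.am * x 0 + c.bm) * c.alphaDot K x]

/-- The vector field of the closed-loop system `x' = (A (θ) + B K (θ) C) x` with `θ = φ (x)`. -/
def closedLoop (K : Plane → ℝ) (x : Plane) : Plane :=
  op (c.Atilde K (c.φ x)) x

/-- The slow-variation assumption on the closed loop over the region `D`, with the sets
`E = φ (D)` of parameters and `F = ψ (D)` of parameter rates. -/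
structure SlowlyVarying (K : Plane → ℝ) (D : Set Plane) (LA m lam : ℝ) : Prop where
  zero_mem : (0 : Plane) ∈ D
  LA_pos : 0 < LA
  one_le_m : 1 ≤ m
  lam_pos : 0 < lam
  /-- `Ã` is Lipschitz on `E` with constant `LA`. -/
  lipschitz : ∀ θ ∈ c.φ '' D, ∀ θ' ∈ c.φ '' D,
    ‖op (c.Atilde K θ - c.Atilde K θ')‖ ≤ LA * ‖θ - θ'‖
  /-- For each frozen `θ ∈ E`, the solutions of `x' = Ã (θ) x` decay exponentially, uniformly. -/
  decay : ∀ θ ∈ c.φ '' D, ∀ x : ℝ → Plane,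
    IsSolutionOn (fun y => op (c.Atilde K θ) y) (Set.Ici 0) x →
      ∀ t : ℝ, 0 ≤ t → ‖x t‖ ≤ m * Real.exp (-lam * t) * ‖x 0‖
  /-- `‖ω‖ < lam² / (4 LA m log m)` for every `ω ∈ F`, where the bound is infinite
  if `m = 1`. -/
  rate : ∀ ω ∈ c.ψ K '' D, 4 * LA * m * Real.log m * ‖ω‖ < lam ^ 2

end Coeffs

end MissileLPV

end

/-!
The statement is local at the equilibrium `0`: when `D` is a neighbourhood of `0`, a small
sublevel set of a Lyapunov function lies in `D` and is positively invariant (Lyapunov's indirect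
method), and the set of *all* good initial states contains it. So `L` is taken to be the set of all
initial states in `D` with the two required properties, and what has to be shown is that it is a
neighbourhood of `0` whenever `D` is.

* `φ` is polynomial and `Ã` is Lipschitz on `φ (D)`, so `x ↦ Ã (φ x)` is Lipschitz near `0`.
  Therefore the closed-loop field `x ↦ Ã (φ x) x` is strictly differentiable at `0` with derivative
  `Ã (φ 0)` (`hasStrictFDerivAt_clm_apply_self`), even though `K` is not assumed differentiable.
* The frozen system at `θ = φ 0` decays exponentially, so `‖exp (T Ã (φ 0))‖ ≤ 1 / 2` for some
  `T > 0`. Then `V x = ∫ s in 0..T, ‖exp (s A) x‖ ^ 2`, with `A = Ã (φ 0)`, is a quadratic form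
  `⟪P x, x⟫`, bounded below by a multiple of `‖x‖ ^ 2`, whose derivative along `x' = A x` is
  `‖exp (T A) x‖ ^ 2 - ‖x‖ ^ 2` (`exists_lyapunov_of_norm_exp_le_half`).
* Since `f x - A x = o (x)`, the derivative of `V` along `x' = f x` is negative on a punctured ball,
  so a solution cannot cross a level of `V` inside this ball (`lyapunov_sublevel_invariant`).
* Solutions on `[0, ∞)` exist because `f` agrees near `0` with a bounded, globally Lipschitz field,
  obtained by composing `f` with a radial retraction; the trapping argument applies to that field
  too, so that its solutions never see the modification.
-/

open Set Filter NormedSpace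
open scoped Topology NNReal RealInnerProductSpace

/-! ### Global solutions for bounded Lipschitz vector fields -/

/-- A bounded, globally Lipschitz vector field has global integral curves. The boundedness lets
the Picard–Lindelöf theorem apply on `[-N, N]` for every `N`. -/
theorem exists_global_solution_of_lipschitzWith_of_bounded {E : Type*} [NormedAddCommGroup E]
    [NormedSpace ℝ E] [CompleteSpace E] {g : E → E} {k M : ℝ≥0} (hg : LipschitzWith k g)
    (hM : ∀ x, ‖g x‖ ≤ M) (x₀ : E) :
    ∃ x : ℝ → E, x 0 = x₀ ∧ ∀ t, HasDerivAt x (g (x t)) t := by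
  have key : ∀ n : ℕ, ∃ α : ℝ → E, α 0 = x₀ ∧
      ∀ t ∈ Ioo (-(n + 1 : ℝ)) (n + 1), HasDerivAt α (g (α t)) t := by
    intro n
    have h0 : (0 : ℝ) ∈ Icc (-(n + 1 : ℝ)) (n + 1) := ⟨by linarith [n.cast_nonneg (α := ℝ)],
      by positivity⟩
    have hpl : IsPicardLindelof (fun _ ↦ g) (⟨0, h0⟩ : Icc (-(n + 1 : ℝ)) (n + 1)) x₀
        (M * (n + 1)) 0 M k := by
      refine IsPicardLindelof.of_time_independent (fun x _ ↦ hM x) hg.lipschitzOnWith ?_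
      simp
    obtain ⟨α, hα0, hα⟩ := hpl.exists_eq_forall_mem_Icc_hasDerivWithinAt₀
    exact ⟨α, hα0, fun t ht ↦ (hα t (Ioo_subset_Icc_self ht)).hasDerivAt (Icc_mem_nhds ht.1 ht.2)⟩
  choose α hα0 hα using key
  have agree : ∀ m n : ℕ, m ≤ n → EqOn (α m) (α n) (Ioo (-(m + 1 : ℝ)) (m + 1)) := by
    intro m n hmn
    have hmn' : (m : ℝ) ≤ n := by exact_mod_cast hmn
    refine ODE_solution_unique_of_mem_Ioo (v := fun _ ↦ g) (s := fun _ ↦ univ) (t₀ := 0)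
      (fun _ _ ↦ hg.lipschitzOnWith)
      ⟨by linarith [m.cast_nonneg (α := ℝ)], by positivity⟩
      (fun t ht ↦ ⟨hα m t ht, trivial⟩) (fun t ht ↦ ⟨hα n t ⟨?_, ?_⟩, trivial⟩) (by simp [hα0])
    · linarith [ht.1]
    · linarith [ht.2]
  have mem_ceil : ∀ t : ℝ, t ∈ Ioo (-((⌈|t|⌉₊ : ℝ) + 1)) ((⌈|t|⌉₊ : ℝ) + 1) := fun t ↦
    abs_lt.1 ((Nat.le_ceil |t|).trans_lt (lt_add_one _))
  refine ⟨fun t ↦ α ⌈|t|⌉₊ t, by simp [hα0], fun t ↦ ?_⟩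
  have hlocal : (fun s ↦ α ⌈|s|⌉₊ s) =ᶠ[𝓝 t] α ⌈|t|⌉₊ := by
    filter_upwards [isOpen_Ioo.mem_nhds (mem_ceil t)] with s hs
    rcases le_total ⌈|s|⌉₊ ⌈|t|⌉₊ with h | h
    · exact agree _ _ h (mem_ceil s)
    · exact (agree _ _ h hs).symm
  exact (hα _ t (mem_ceil t)).congr_of_eventuallyEq hlocal

/-- The radial map `x ↦ (R / max R ‖x‖) • x`, which for `R > 0` retracts a normed space onto the
closed ball of radius `R` about `0`. -/
noncomputable def radialRetraction {E : Type*} [NormedAddCommGroup E] [NormedSpace ℝ E] (R : ℝ)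
    (x : E) : E :=
  (R / max R ‖x‖) • x

section radialRetraction

variable {E : Type*} [NormedAddCommGroup E] [NormedSpace ℝ E] {R : ℝ}

theorem radialRetraction_of_norm_le (hR : 0 < R) {x : E} (hx : ‖x‖ ≤ R) :
    radialRetraction R x = x := by
  rw [radialRetraction, max_eq_left hx, div_self hR.ne', one_smul]

theorem norm_radialRetraction_le (hR : 0 < R) (x : E) : ‖radialRetraction R x‖ ≤ R := by
  have hm : 0 < max R ‖x‖ := lt_max_of_lt_left hR
  rw [radialRetraction, norm_smul, Real.norm_of_nonneg (by positivity), div_mul_eq_mul_div,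
    div_le_iff₀ hm]
  gcongr
  exact le_max_right _ _

theorem lipschitzWith_radialRetraction (hR : 0 < R) :
    LipschitzWith 2 (radialRetraction R : E → E) := by
  refine LipschitzWith.of_dist_le_mul fun x y ↦ ?_
  have hx : 0 < max R ‖x‖ := lt_max_of_lt_left hR
  have hy : 0 < max R ‖y‖ := lt_max_of_lt_left hR
  have hmax : |max R ‖y‖ - max R ‖x‖| ≤ ‖x - y‖ := by
    calc |max R ‖y‖ - max R ‖x‖| ≤ max |R - R| |‖y‖ - ‖x‖| := abs_max_sub_max_le_max _ _ _ _
      _ ≤ ‖x - y‖ := by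
        simp only [sub_self, abs_zero]
        exact max_le (norm_nonneg _) (norm_sub_rev y x ▸ abs_norm_sub_norm_le y x)
  have hsplit : radialRetraction R x - radialRetraction R y =
      (R / max R ‖x‖) • (x - y) +
        ((R / max R ‖x‖) * ((max R ‖y‖ - max R ‖x‖) / max R ‖y‖)) • y := by
    have hc : (R / max R ‖x‖) * ((max R ‖y‖ - max R ‖x‖) / max R ‖y‖) =
        R / max R ‖x‖ - R / max R ‖y‖ := by
      field_simp
    rw [hc, radialRetraction, radialRetraction]
    module
  have h1 : R / max R ‖x‖ ≤ 1 := (div_le_one hx).2 (le_max_left _ _)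
  have h0 : 0 ≤ R / max R ‖x‖ := by positivity
  have hyb : ‖y‖ / max R ‖y‖ ≤ 1 := (div_le_one hy).2 (le_max_right _ _)
  rw [dist_eq_norm, dist_eq_norm, hsplit]
  calc _ ≤ (R / max R ‖x‖) * ‖x - y‖ +
        (R / max R ‖x‖) * (|max R ‖y‖ - max R ‖x‖| * (‖y‖ / max R ‖y‖)) := by
        refine (norm_add_le _ _).trans (add_le_add ?_ ?_)
        · rw [norm_smul, Real.norm_of_nonneg h0]
        · rw [norm_smul, norm_mul, Real.norm_of_nonneg h0, norm_div, Real.norm_eq_abs,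
            Real.norm_of_nonneg hy.le]
          exact le_of_eq (by ring)
    _ ≤ 1 * ‖x - y‖ + 1 * (‖x - y‖ * 1) := by gcongr
    _ = (2 : ℝ≥0) * ‖x - y‖ := by push_cast; ring

end radialRetraction

/-- A vector field that is Lipschitz on a ball about `0` agrees there with a field all of whose
integral curves are global. -/
theorem exists_global_solution_of_lipschitzOnWith_closedBall {E : Type*} [NormedAddCommGroup E]
    [NormedSpace ℝ E] [CompleteSpace E] {f : E → E} {k : ℝ≥0} {R : ℝ} (hR : 0 < R)
    (hf : LipschitzOnWith k f (Metric.closedBall 0 R)) :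
    ∃ g : E → E, EqOn g f (Metric.closedBall 0 R) ∧
      ∀ x₀, ∃ x : ℝ → E, x 0 = x₀ ∧ ∀ t, HasDerivAt x (g (x t)) t := by
  have hmaps : ∀ x : E, radialRetraction R x ∈ Metric.closedBall (0 : E) R := fun x ↦
    mem_closedBall_zero_iff.2 (norm_radialRetraction_le hR x)
  refine ⟨f ∘ radialRetraction R, fun x hx ↦ ?_, fun x₀ ↦ ?_⟩
  · rw [Function.comp_apply, radialRetraction_of_norm_le hR (mem_closedBall_zero_iff.1 hx)]
  · have hlip : LipschitzWith (k * 2) (f ∘ radialRetraction R) := by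
      rw [← lipschitzOnWith_univ]
      exact hf.comp (lipschitzWith_radialRetraction hR).lipschitzOnWith fun x _ ↦ hmaps x
    have h0 : (0 : E) ∈ Metric.closedBall (0 : E) R := Metric.mem_closedBall_self hR.le
    refine exists_global_solution_of_lipschitzWith_of_bounded
      (M := ‖f 0‖₊ + k * R.toNNReal) hlip (fun x ↦ ?_) x₀
    have h1 := hf.norm_sub_le (hmaps x) h0
    have h2 := norm_radialRetraction_le hR x
    have h3 : ‖f (radialRetraction R x)‖ ≤
        ‖f (radialRetraction R x) - f 0‖ + ‖f 0‖ := norm_le_norm_sub_add _ _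
    rw [sub_zero] at h1
    push_cast
    rw [Real.coe_toNNReal R hR.le]
    have h4 : (k : ℝ) * ‖radialRetraction R x‖ ≤ k * R := by gcongr
    simp only [Function.comp_apply]
    linarith

/-! ### A quadratic Lyapunov function for a stable linear system -/

section Lyapunov

variable {E : Type*} [NormedAddCommGroup E] [InnerProductSpace ℝ E]

theorem hasDerivAt_exp_smul_apply [CompleteSpace E] (A : E →L[ℝ] E) (x : E) (t : ℝ) :
    HasDerivAt (fun s : ℝ ↦ exp (s • A) x) (A (exp (t • A) x)) t := by
  have h := (hasDerivAt_exp_smul_const' A t).clm_apply (hasDerivAt_const t x)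
  simpa using h

theorem exp_smul_apply_comm (A : E →L[ℝ] E) (x : E) (t : ℝ) :
    exp (t • A) (A x) = A (exp (t • A) x) := by
  have h : Commute (exp (t • A)) A := ((Commute.refl A).smul_left t).exp_left
  exact congrArg (fun B : E →L[ℝ] E ↦ B x) h.eq

theorem continuous_exp_smul [CompleteSpace E] (A : E →L[ℝ] E) :
    Continuous fun s : ℝ ↦ exp (s • A) :=
  continuous_iff_continuousAt.2 fun t ↦ (hasDerivAt_exp_smul_const' A t).continuousAt

/-- If `exp (T A)` is a contraction, the operator `P = ∫ s in 0..T, exp (s A)† exp (s A)` defines a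
coercive quadratic form that strictly decreases along `x' = A x`. -/
theorem exists_lyapunov_of_norm_exp_le_half [CompleteSpace E] {A : E →L[ℝ] E} {T : ℝ} (hT : 0 < T)
    (hA : ‖exp (T • A)‖ ≤ 1 / 2) :
    ∃ (P : E →L[ℝ] E) (c : ℝ), 0 < c ∧ (∀ x y, ⟪P x, y⟫ = ⟪P y, x⟫) ∧
      (∀ x, c * ‖x‖ ^ 2 ≤ ⟪P x, x⟫) ∧ ∀ x, 2 * ⟪P x, A x⟫ ≤ -(1 / 2) * ‖x‖ ^ 2 := by
  set Φ : ℝ → E →L[ℝ] E := fun s ↦ exp (s • A) with hΦ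
  have hΦc : Continuous Φ := continuous_exp_smul A
  have hΨc : Continuous fun s ↦ ContinuousLinearMap.adjoint (Φ s) ∘L Φ s := by
    exact (ContinuousLinearMap.adjoint.continuous.comp hΦc).clm_comp hΦc
  set P : E →L[ℝ] E := ∫ s in (0 : ℝ)..T, ContinuousLinearMap.adjoint (Φ s) ∘L Φ s with hP
  have hPform : ∀ x y, ⟪P x, y⟫ = ∫ s in (0 : ℝ)..T, ⟪Φ s x, Φ s y⟫ := by
    intro x y
    have h := ((innerSL ℝ y) ∘L (ContinuousLinearMap.apply ℝ E x)).intervalIntegral_comp_comm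
      (hΨc.intervalIntegrable (μ := MeasureTheory.volume) 0 T)
    rw [real_inner_comm]
    refine Eq.trans h.symm ?_
    refine intervalIntegral.integral_congr fun s _ ↦ ?_
    simp [ContinuousLinearMap.adjoint_inner_right, real_inner_comm]
  obtain ⟨M, hM⟩ := (isCompact_Icc (a := (0 : ℝ)) (b := T)).exists_bound_of_continuousOn
    (f := fun s ↦ exp (-(s • A)))
    (by
      have : Continuous fun s : ℝ ↦ exp ((-s) • A) := (continuous_exp_smul A).comp continuous_neg
      simpa only [neg_smul] using this.continuousOn)
  have hM1 : 0 < max M 1 := lt_max_of_lt_right one_pos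
  -- `exp (-s A)` inverts `exp (s A)`, so its bound on `[0, T]` bounds `exp (s A)` from below.
  have hlow : ∀ s ∈ Icc (0 : ℝ) T, ∀ x, (max M 1 ^ 2)⁻¹ * ‖x‖ ^ 2 ≤ ⟪Φ s x, Φ s x⟫ := by
    intro s hs x
    have hinv : exp (-(s • A)) * Φ s = 1 := by
      -- `exp_add_of_commute` is stated for normed algebras over `ℚ`.
      let _ : NormedAlgebra ℚ (E →L[ℝ] E) := NormedAlgebra.restrictScalars ℚ ℝ (E →L[ℝ] E)
      rw [hΦ, ← exp_add_of_commute (Commute.refl (s • A)).neg_left, neg_add_cancel, exp_zero]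
    have hx : x = exp (-(s • A)) (Φ s x) :=
      (congrArg (fun B : E →L[ℝ] E ↦ B x) hinv).symm
    have hle : ‖x‖ ≤ max M 1 * ‖Φ s x‖ := by
      calc ‖x‖ = ‖exp (-(s • A)) (Φ s x)‖ := by rw [← hx]
        _ ≤ ‖exp (-(s • A))‖ * ‖Φ s x‖ := ContinuousLinearMap.le_opNorm _ _
        _ ≤ max M 1 * ‖Φ s x‖ := by
          gcongr
          exact (hM s hs).trans (le_max_left _ _)
    rw [real_inner_self_eq_norm_sq, inv_mul_le_iff₀ (by positivity), ← mul_pow]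
    gcongr
  have hcont : ∀ x y, Continuous fun s ↦ ⟪Φ s x, Φ s y⟫ := fun x y ↦
    (hΦc.clm_apply continuous_const).inner (hΦc.clm_apply continuous_const)
  refine ⟨P, T * (max M 1 ^ 2)⁻¹, by positivity, fun x y ↦ ?_, fun x ↦ ?_, fun x ↦ ?_⟩
  · rw [hPform, hPform]
    exact intervalIntegral.integral_congr fun s _ ↦ real_inner_comm _ _
  · rw [hPform]
    have h := intervalIntegral.integral_mono_on (μ := MeasureTheory.volume) hT.le
      (continuous_const.intervalIntegrable (u := fun _ ↦ (max M 1 ^ 2)⁻¹ * ‖x‖ ^ 2) 0 T)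
      ((hcont x x).intervalIntegrable 0 T) fun s hs ↦ hlow s hs x
    rw [intervalIntegral.integral_const, sub_zero, smul_eq_mul] at h
    linarith
  · have hderiv : ∀ s ∈ uIcc (0 : ℝ) T,
        HasDerivAt (fun s ↦ ⟪Φ s x, Φ s x⟫) (2 * ⟪Φ s x, Φ s (A x)⟫) s := by
      intro s _
      have h := (hasDerivAt_exp_smul_apply A x s).inner ℝ (hasDerivAt_exp_smul_apply A x s)
      convert! h using 1
      rw [hΦ]
      simp only [exp_smul_apply_comm]
      rw [real_inner_comm (exp (s • A) x), two_mul]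
    have h := intervalIntegral.integral_eq_sub_of_hasDerivAt hderiv
      (((hcont x (A x)).const_mul 2).intervalIntegrable 0 T)
    rw [intervalIntegral.integral_const_mul, ← hPform] at h
    rw [h]
    have h0 : Φ 0 = 1 := by simp [hΦ]
    have hTx : ‖Φ T x‖ ≤ 1 / 2 * ‖x‖ := (Φ T).le_of_opNorm_le hA x
    simp only [h0, real_inner_self_eq_norm_sq, one_apply_eq_self]
    nlinarith [norm_nonneg (Φ T x), norm_nonneg x]

/-- A level of a quadratic form `⟪P x, x⟫` on which the form strictly decreases in the direction of
`f` cannot be crossed outwards by a solution of `x' = f x`. -/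
theorem lyapunov_sublevel_invariant {f : E → E} {P : E →L[ℝ] E}
    (hP : ∀ x y, ⟪P x, y⟫ = ⟪P y, x⟫) {r : ℝ}
    (hdec : ∀ x, ⟪P x, x⟫ = r → ⟪P x, f x⟫ < 0) {x : ℝ → E} {T : ℝ}
    (hx : ∀ t ∈ Ico 0 T, HasDerivWithinAt x (f (x t)) (Ico 0 T) t)
    (h0 : ⟪P (x 0), x 0⟫ ≤ r) {t : ℝ} (ht : t ∈ Ico 0 T) : ⟪P (x t), x t⟫ ≤ r := by
  have hV : ∀ s ∈ Ico 0 T, HasDerivWithinAt (fun s ↦ ⟪P (x s), x s⟫)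
      (2 * ⟪P (x s), f (x s)⟫) (Ico 0 T) s := by
    intro s hs
    have h := (P.hasFDerivAt.comp_hasDerivWithinAt s (hx s hs)).inner ℝ (hx s hs)
    convert! h using 1
    rw [hP (f (x s)), two_mul]
    rfl
  have hsub : Icc 0 t ⊆ Ico 0 T := fun s hs ↦ ⟨hs.1, hs.2.trans_lt ht.2⟩
  refine image_le_of_deriv_right_lt_deriv_boundary' (a := 0) (b := t)
    (f' := fun s ↦ 2 * ⟪P (x s), f (x s)⟫) (B := fun _ ↦ r) (B' := fun _ ↦ 0)
    (fun s hs ↦ ((hV s (hsub hs)).continuousWithinAt).mono hsub) (fun s hs ↦ ?_) h0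
    continuousOn_const (fun s _ ↦ hasDerivWithinAt_const _ _ _) (fun s _ hs ↦ ?_) ⟨ht.1, le_rfl⟩
  · have hs' : s ∈ Ico 0 T := hsub ⟨hs.1, hs.2.le⟩
    refine (hV s hs').mono_of_mem_nhdsWithin ?_
    filter_upwards [Ico_mem_nhdsGE hs'.2] with u hu using ⟨hs'.1.trans hu.1, hu.2⟩
  · have := hdec (x s) hs
    linarith

/-- **Lyapunov's indirect method**, in the form of invariant neighbourhoods: if the derivative `A`
of `f` at the equilibrium `0` generates a semigroup that becomes a contraction, then every
neighbourhood `D` of `0` contains the whole forward orbits of all states near `0`. -/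
theorem eventually_solutions_stay_of_hasStrictFDerivAt [CompleteSpace E] {f : E → E}
    {A : E →L[ℝ] E} (hf : HasStrictFDerivAt f A 0) (hf0 : f 0 = 0) {T₀ : ℝ} (hT₀ : 0 < T₀)
    (hA : ‖exp (T₀ • A)‖ ≤ 1 / 2) {D : Set E} (hD : D ∈ 𝓝 0) :
    ∀ᶠ x₀ in 𝓝 (0 : E),
      (∃ x : ℝ → E, x 0 = x₀ ∧ (∀ t ∈ Ici (0 : ℝ), HasDerivWithinAt x (f (x t)) (Ici 0) t) ∧
        ∀ t, 0 ≤ t → x t ∈ D) ∧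
      ∀ (T : ℝ) (x : ℝ → E), x 0 = x₀ →
        (∀ t ∈ Ico 0 T, HasDerivWithinAt x (f (x t)) (Ico 0 T) t) → ∀ t ∈ Ico 0 T, x t ∈ D := by
  obtain ⟨P, c, hc, hPsymm, hPlow, hPA⟩ := exists_lyapunov_of_norm_exp_le_half hT₀ hA
  obtain ⟨k, s, hs, hlip⟩ := hf.exists_lipschitzOnWith
  -- With this `ε`, the perturbation `f x - A x` spoils at most half of the decrease of the form.
  set ε : ℝ := 1 / (8 * (‖P‖ + 1)) with hε
  have hεpos : 0 < ε := by positivity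
  have hsmall : ∀ᶠ x in 𝓝 (0 : E), ‖f x - A x‖ ≤ ε * ‖x‖ := by
    simpa [hf0] using hf.hasFDerivAt.isLittleO.def hεpos
  obtain ⟨R, hR, hball⟩ := Metric.nhds_basis_closedBall.mem_iff.1
    (inter_mem (inter_mem hs hD) hsmall)
  have hin : ∀ x : E, ⟪P x, x⟫ ≤ c * R ^ 2 → x ∈ Metric.closedBall (0 : E) R := by
    intro x hx
    have h : ‖x‖ ^ 2 ≤ R ^ 2 := le_of_mul_le_mul_left ((hPlow x).trans hx) hc
    exact mem_closedBall_zero_iff.2 (abs_le_of_sq_le_sq' h hR.le).2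
  have hdec : ∀ x : E, ⟪P x, x⟫ = c * R ^ 2 → ⟪P x, f x⟫ < 0 := by
    intro x hx
    have hx0 : 0 < ‖x‖ := by
      refine norm_pos_iff.2 fun h ↦ ?_
      rw [h, inner_zero_right] at hx
      have : 0 < c * R ^ 2 := by positivity
      linarith
    have herr : ‖f x - A x‖ ≤ ε * ‖x‖ := (hball (hin x hx.le)).2
    have h1 : ⟪P x, f x - A x⟫ ≤ 1 / 8 * ‖x‖ ^ 2 := by
      calc ⟪P x, f x - A x⟫ ≤ ‖P x‖ * ‖f x - A x‖ := real_inner_le_norm _ _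
        _ ≤ ((‖P‖ + 1) * ‖x‖) * (ε * ‖x‖) := by
          gcongr
          refine (P.le_opNorm x).trans ?_
          gcongr
          linarith
        _ = 1 / 8 * ‖x‖ ^ 2 := by
          rw [hε]
          field_simp
    have h2 := hPA x
    rw [inner_sub_right] at h1
    nlinarith [sq_pos_of_pos hx0]
  have hnear : ∀ᶠ x₀ in 𝓝 (0 : E), ⟪P x₀, x₀⟫ ≤ c * R ^ 2 := by
    have hcont : Continuous fun x ↦ ⟪P x, x⟫ := P.continuous.inner continuous_id
    have hlt : ⟪P 0, (0 : E)⟫ < c * R ^ 2 := by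
      rw [inner_zero_right]
      positivity
    exact (hcont.continuousAt.eventually_lt continuousAt_const hlt).mono fun _ h ↦ h.le
  obtain ⟨g, hgf, hg⟩ := exists_global_solution_of_lipschitzOnWith_closedBall hR
    (hlip.mono fun x hx ↦ (hball hx).1.1)
  filter_upwards [hnear] with x₀ hx₀
  refine ⟨?_, fun T x h0 hx t ht ↦ ?_⟩
  · obtain ⟨x, h0, hx⟩ := hg x₀
    have hmem : ∀ t, 0 ≤ t → x t ∈ Metric.closedBall (0 : E) R := fun t ht ↦
      hin _ (lyapunov_sublevel_invariant (f := g) (T := t + 1) hPsymm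
        (fun y hy ↦ by rw [hgf (hin y hy.le)]; exact hdec y hy)
        (fun s _ ↦ (hx s).hasDerivWithinAt) (by rwa [h0]) ⟨ht, lt_add_one t⟩)
    refine ⟨x, h0, fun t ht ↦ ?_, fun t ht ↦ (hball (hmem t ht)).1.2⟩
    rw [← hgf (hmem t ht)]
    exact (hx t).hasDerivWithinAt
  · exact (hball (hin _ (lyapunov_sublevel_invariant hPsymm hdec hx (by rwa [h0]) ht))).1.2

end Lyapunov

/-! ### The closed loop near the origin -/

/-- If `B` is Lipschitz near `0`, then `x ↦ B x x` is strictly differentiable at `0`, although `B`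
need not be differentiable. -/
theorem hasStrictFDerivAt_clm_apply_self {E F : Type*} [NormedAddCommGroup E] [NormedSpace ℝ E]
    [NormedAddCommGroup F] [NormedSpace ℝ F] {B : E → E →L[ℝ] F} {k : ℝ≥0} {s : Set E}
    (hs : s ∈ 𝓝 0) (hB : LipschitzOnWith k B s) :
    HasStrictFDerivAt (fun x ↦ B x x) (B 0) 0 := by
  refine HasStrictFDerivAt.of_isLittleO (Asymptotics.isLittleO_iff.2 fun ε hε ↦ ?_)
  have hsmall : ∀ᶠ p : E × E in 𝓝 (0, 0), k * (‖p.1‖ + ‖p.2‖) < ε := by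
    have hcont : Continuous fun p : E × E ↦ k * (‖p.1‖ + ‖p.2‖) := by fun_prop
    exact hcont.continuousAt.eventually_lt continuousAt_const (by simpa using hε)
  have hmem : ∀ᶠ p : E × E in 𝓝 (0, 0), p.1 ∈ s ∧ p.2 ∈ s := prod_mem_nhds hs hs
  filter_upwards [hsmall, hmem] with p hp ⟨h1, h2⟩
  have hsplit : B p.1 p.1 - B p.2 p.2 - B 0 (p.1 - p.2) =
      (B p.1 - B 0) (p.1 - p.2) + (B p.1 - B p.2) p.2 := by
    simp only [sub_apply, map_sub]
    abel
  have e1 : ‖B p.1 - B 0‖ ≤ k * ‖p.1‖ := by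
    simpa using hB.norm_sub_le h1 (mem_of_mem_nhds hs)
  have e2 : ‖B p.1 - B p.2‖ ≤ k * ‖p.1 - p.2‖ := hB.norm_sub_le h1 h2
  rw [hsplit]
  calc _ ≤ k * ‖p.1‖ * ‖p.1 - p.2‖ + k * ‖p.1 - p.2‖ * ‖p.2‖ :=
        (norm_add_le _ _).trans (add_le_add (ContinuousLinearMap.le_of_opNorm_le _ e1 _)
          (ContinuousLinearMap.le_of_opNorm_le _ e2 _))
    _ = k * (‖p.1‖ + ‖p.2‖) * ‖p.1 - p.2‖ := by ring
    _ ≤ ε * ‖p.1 - p.2‖ := by gcongr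

/-- Uniform exponential decay of the solutions of `x' = A x` makes `exp (T A)` a contraction for
some `T > 0`. -/
theorem exists_norm_exp_le_half_of_decay {E : Type*} [NormedAddCommGroup E]
    [InnerProductSpace ℝ E] [CompleteSpace E] {A : E →L[ℝ] E} {m lam : ℝ} (hm : 0 ≤ m)
    (hlam : 0 < lam)
    (h : ∀ x : ℝ → E, (∀ t, HasDerivAt x (A (x t)) t) →
      ∀ t, 0 ≤ t → ‖x t‖ ≤ m * Real.exp (-lam * t) * ‖x 0‖) :
    ∃ T : ℝ, 0 < T ∧ ‖exp (T • A)‖ ≤ 1 / 2 := by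
  have hlim : Tendsto (fun t : ℝ ↦ m * Real.exp (-lam * t)) atTop (𝓝 (m * 0)) :=
    (Real.tendsto_exp_atBot.comp
      (tendsto_id.const_mul_atTop_of_neg (neg_neg_of_pos hlam))).const_mul m
  rw [mul_zero] at hlim
  obtain ⟨T, hT, hT0⟩ := ((hlim.eventually_lt_const (show (0 : ℝ) < 1 / 2 by norm_num)).and
    (eventually_gt_atTop 0)).exists
  refine ⟨T, hT0, (ContinuousLinearMap.opNorm_le_bound _ (by positivity) fun y ↦ ?_).trans hT.le⟩
  simpa using h (fun t ↦ exp (t • A) y) (hasDerivAt_exp_smul_apply A y) T hT0.le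

theorem MissileLPV.Coeffs.contDiff_φ (c : MissileLPV.Coeffs) : ContDiff ℝ 1 c.φ := by
  rw [contDiff_euclidean]
  intro i
  fin_cases i <;> simp only [MissileLPV.Coeffs.φ] <;> simp <;> fun_prop

/-- Near `0` the closed-loop matrix, as a function of the state, is Lipschitz. -/
theorem MissileLPV.Coeffs.SlowlyVarying.exists_lipschitzOnWith {c : MissileLPV.Coeffs}
    {K : MissileLPV.Plane → ℝ} {D : Set MissileLPV.Plane} {LA m lam : ℝ}
    (h : c.SlowlyVarying K D LA m lam) (hD : D ∈ 𝓝 0) :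
    ∃ k : ℝ≥0, ∃ s ∈ 𝓝 (0 : MissileLPV.Plane),
      LipschitzOnWith k (fun x ↦ MissileLPV.op (c.Atilde K (c.φ x))) s := by
  obtain ⟨k, s, hs, hk⟩ := c.contDiff_φ.contDiffAt.exists_lipschitzOnWith (x := 0)
  refine ⟨LA.toNNReal * k, s ∩ D, inter_mem hs hD,
    LipschitzOnWith.of_dist_le_mul fun x hx y hy ↦ ?_⟩
  rw [dist_eq_norm, ← map_sub]
  calc _ ≤ LA * ‖c.φ x - c.φ y‖ :=
        h.lipschitz _ (mem_image_of_mem _ hx.2) _ (mem_image_of_mem _ hy.2)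
    _ ≤ LA * (k * dist x y) := by
        gcongr
        · exact h.LA_pos.le
        · rw [← dist_eq_norm]
          exact hk.dist_le_mul x hx.1 y hy.1
    _ = _ := by rw [NNReal.coe_mul, Real.coe_toNNReal _ h.LA_pos.le, mul_assoc]

theorem mainTheorem6 (c : MissileLPV.Coeffs) (η ϱ : MvPolynomial (Fin 3) ℝ)
    (K : MissileLPV.Plane → ℝ) (D : Set MissileLPV.Plane) (LA m lam : ℝ)
    (hK : MissileLPV.IsRootGain η ϱ (c.φ '' D) K)
    (hD : c.SlowlyVarying K D LA m lam) :
    ∃ L : Set MissileLPV.Plane, L ⊆ D ∧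
      (D ∈ 𝓝 (0 : MissileLPV.Plane) → L ∈ 𝓝 (0 : MissileLPV.Plane)) ∧
      ∀ x₀ ∈ L,
        (∃ x : ℝ → MissileLPV.Plane, x 0 = x₀ ∧
          MissileLPV.IsSolutionOn (c.closedLoop K) (Set.Ici 0) x ∧ ∀ t : ℝ, 0 ≤ t → x t ∈ D) ∧
        (∀ (T : ℝ) (x : ℝ → MissileLPV.Plane), x 0 = x₀ →
          MissileLPV.IsSolutionOn (c.closedLoop K) (Set.Ico 0 T) x →
            ∀ t ∈ Set.Ico 0 T, x t ∈ D) := by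
  refine ⟨{x₀ ∈ D | _}, fun x h ↦ h.1, fun hDnhds ↦ ?_, fun x₀ h ↦ h.2⟩
  obtain ⟨k, s, hs, hlip⟩ := hD.exists_lipschitzOnWith hDnhds
  have hstrict := hasStrictFDerivAt_clm_apply_self hs hlip
  obtain ⟨T, hT, hTA⟩ := exists_norm_exp_le_half_of_decay
    (A := MissileLPV.op (c.Atilde K (c.φ 0))) (zero_le_one.trans hD.one_le_m) hD.lam_pos
    fun x hx ↦ hD.decay _ (mem_image_of_mem _ hD.zero_mem) x fun t _ ↦ (hx t).hasDerivWithinAt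
  filter_upwards [hDnhds, eventually_solutions_stay_of_hasStrictFDerivAt hstrict (map_zero _) hT hTA
    hDnhds] with x₀ h1 h2 using ⟨h1, h2⟩
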